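/- For $d,m,\ell\in\mathbb N_0$ with $\ell\le d$ put $[m,\ell]^d=(m+1)^{\ell}m^{d-\ell}$. Let $\mathbb Z^d$ also denote the grid graph on the integer points, in which $x,y$ are adjacent iff $\sum_{i=1}^d|x_i-y_i|=1$. For a finite set $S\subseteq\mathbb Z^d$ let $E_d(S)$ be the number of edges of the subgraph of $\mathbb Z^d$ induced by $S$, and let $E_d(n)=\max\{E_d(S): S\subseteq\mathbb Z^d,\ |S|=n\}$. Theorem. Let $d,n\ge 1$ be integers. Then $n$ has a unique pseudo $d$-cubic representation $$n=[m_d,\ell_d]^d+[m_{d-1},\ell_{d-1}]^{d-1}+\cdots+[m_c,\ell_c]^c,$$ where $1\le c\le d$, $m_c\ge 1$, $\ell_i\in\{0,1,\dots,i-1\}$ for $c\le i\le d$, and $(m_d,\ell_d)>(m_{d-1},\ell_{d-1})>\cdots>(m_c,\ell_c)$ lexicographically. With this representation, $$E_d(n)=dn-\delta_d(n),\qquad \delta_d(n)=\sum_{i=c}^d\left(\ell_i[m_i,\ell_i-1]^{i-1}+(i-\ell_i)[m_i,\ell_i]^{i-1}\right),$$ where the term $\ell_i[m_i,\ell_i-1]^{i-1}$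 is read as $0$ if $\ell_i=0$. The maximum is attained by the $d$-cubicle $\llbracket n\rrbracket^d$, a set of $n$ points with positive integer coordinates. It is defined recursively by $\llbracket 0\rrbracket^i=\emptyset$ and $$\llbracket n\rrbracket^d=\left(\{1,\dots,m_d+1\}^{\ell_d}\times\{1,\dots,m_d\}^{d-\ell_d}\right)\cup\lambda\left(\llbracket n-[m_d,\ell_d]^d\rrbracket^{d-1}\right),$$ where $n-[m_d,\ell_d]^d$ has the representation $[m_{d-1},\ell_{d-1}]^{d-1}+\cdots+[m_c,\ell_c]^c$ (the empty sum if $c=d$), and $\lambda:\mathbb Z^{d-1}\to\mathbb Z^d$ inserts the value $m_d+1$ as the coordinate number $\ell_d+1$. In particular, the maximum over the sets of $n$ points with positive integer coordinates is also $dn-\delta_d(n)$. -/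

import Mathlib

/-- The grid graph `ℤ^d`: two points are adjacent iff their Manhattan distance is `1`. -/
def gridGraph (d : ℕ) : SimpleGraph (Fin d → ℤ) where
  Adj x y := ∑ i, |x i - y i| = 1
  symm := ⟨fun x y h => by simpa only [abs_sub_comm] using h⟩
  loopless := ⟨fun x h => by simp at h⟩

/-- `E_d(S)`: the number of edges of the subgraph of the grid `ℤ^d` induced by the finite
set `S`. -/
noncomputable def inducedEdges {d : ℕ} (S : Finset (Fin d → ℤ)) : ℕ :=
  ((gridGraph d).induce (S : Set (Fin d → ℤ))).edgeSet.ncard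

/-- The number `[m,ℓ]^d = (m+1)^ℓ m^(d-ℓ)`, only used for `ℓ ≤ d`. -/
def pseudoCubic (m l d : ℕ) : ℕ := (m + 1) ^ l * m ^ (d - l)

/-- The pseudo `d`-cube `⟦m,ℓ⟧^d = {1,…,m+1}^ℓ × {1,…,m}^(d-ℓ)`. -/
noncomputable def pseudoCube (m l d : ℕ) : Finset (Fin d → ℤ) :=
  Fintype.piFinset fun i : Fin d =>
    if (i : ℕ) < l then Finset.Icc (1 : ℤ) ((m : ℤ) + 1) else Finset.Icc (1 : ℤ) (m : ℤ)

/-- `n = [m_d,ℓ_d]^d + ⋯ + [m_c,ℓ_c]^c` is a pseudo `d`-cubic representation of `n`.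
Only the values of `m` and `l` at `c, …, d` matter. -/
structure IsPCR (d n c : ℕ) (m l : ℕ → ℕ) : Prop where
  one_le_c : 1 ≤ c
  c_le : c ≤ d
  one_le_m : 1 ≤ m c
  l_lt : ∀ i ∈ Finset.Icc c d, l i < i
  lex : ∀ i ∈ Finset.Ico c d, toLex (m i, l i) < toLex (m (i + 1), l (i + 1))
  sum_eq : n = ∑ i ∈ Finset.Icc c d, pseudoCubic (m i) (l i) i

/-- The discrepancy `∑_{i=c}^d (ℓ_i [m_i,ℓ_i-1]^{i-1} + (i-ℓ_i) [m_i,ℓ_i]^{i-1})`.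
For `ℓ_i = 0` the first summand is `0`; otherwise no subtraction truncates, as
`ℓ_i < i` in a representation. -/
def discrepancy (d c : ℕ) (m l : ℕ → ℕ) : ℕ :=
  ∑ i ∈ Finset.Icc c d,
    (l i * pseudoCubic (m i) (l i - 1) (i - 1) + (i - l i) * pseudoCubic (m i) (l i) (i - 1))

/-- The `d`-cubicle of the representation `[m_d,ℓ_d]^d + ⋯ + [m_c,ℓ_c]^c`: the pseudo cube
`⟦m_d,ℓ_d⟧^d` together with the `(d-1)`-cubicle of the remaining terms, which is lifted by
inserting `m_d + 1` as the coordinate number `ℓ_d + 1` (the index `ℓ_d` in `Fin d`).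
The cubicle of the empty sum is empty. -/
noncomputable def cubicle (c : ℕ) (m l : ℕ → ℕ) : (d : ℕ) → Finset (Fin d → ℤ)
  | 0 => ∅
  | d + 1 =>
    if d + 1 < c then ∅
    else pseudoCube (m (d + 1)) (l (d + 1)) (d + 1) ∪
      (cubicle c m l d).image fun x =>
        Fin.insertNth (α := fun _ => ℤ) (Fin.ofNat (d + 1) (l (d + 1)))
          ((m (d + 1) : ℤ) + 1) x

/-! Assign each edge to its lower endpoint and its direction. Then `d * n` minus the number of edges
counts, over all directions, the points whose upper neighbour is missing (`tops`). Every line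
meeting the set has such a point, so this count is at least the sum of the sizes of the `d`
coordinate projections, with equality for down-closed sets. It remains to minimise that sum.

The candidate minimum `minFacets` follows the greedy growth of pseudo cubes: fill one facet at a
time, and fill each facet optimally in one dimension less.

For the lower bound, choose a direction with the largest number `k` of nonempty layers, so that `n ≤
k ^ d`, and remove a thinnest layer, of size `a` with `k * a ≤ n`. In every other direction the
projections of the layer and of the rest are disjoint. Induction reduces the bound to the numerical
inequality `minFacets_le_remove_layer`, which rests on `MergeIneq`: shifting points from a smaller
set to a larger one never increases the total of `minFacets`.

The cubicle is down-closed, and each of its layers lies on a box that already covers the layer's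
projection in the stacking direction, so it attains the bound. The lexicographic condition says
exactly that the representation is greedy. -/

/-! ### Arithmetic of pseudo cubes and greedy blocks. -/

lemma pseudoCubic_succ_succ (m l e : ℕ) :
    pseudoCubic m (l + 1) (e + 1) = (m + 1) * pseudoCubic m l e := by
  simp [pseudoCubic, pow_succ]; ring

lemma pseudoCubic_succ_dim {m l e : ℕ} (h : l ≤ e) :
    pseudoCubic m l (e + 1) = m * pseudoCubic m l e := by
  rw [pseudoCubic, pseudoCubic, Nat.succ_sub h, pow_succ]; ring

lemma pseudoCubic_add_layer {m l e : ℕ} (h : l ≤ e) :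
    pseudoCubic m l (e + 1) + pseudoCubic m l e = pseudoCubic m (l + 1) (e + 1) := by
  rw [pseudoCubic_succ_succ, pseudoCubic_succ_dim h]; ring

lemma pseudoCubic_zero (m d : ℕ) : pseudoCubic m 0 d = m ^ d := by simp [pseudoCubic]

lemma pseudoCubic_self (m d : ℕ) : pseudoCubic m d d = (m + 1) ^ d := by simp [pseudoCubic]

lemma pseudoCubic_pos {m : ℕ} (l d : ℕ) (hm : 1 ≤ m) : 1 ≤ pseudoCubic m l d := by
  unfold pseudoCubic; exact Nat.succ_le_of_lt (by positivity)

lemma pseudoCubic_mono_right {m l l' d : ℕ} (h : l ≤ l') (h' : l' ≤ d) :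
    pseudoCubic m l d ≤ pseudoCubic m l' d := by
  obtain ⟨k, rfl⟩ := Nat.exists_eq_add_of_le h
  obtain ⟨j, rfl⟩ := Nat.exists_eq_add_of_le h'
  have e1 : l + k + j - l = k + j := by omega
  have e2 : l + k + j - (l + k) = j := by omega
  rw [pseudoCubic, pseudoCubic, e1, e2, pow_add, pow_add, mul_assoc]
  gcongr
  omega

lemma pseudoCubic_le_pow {m l d : ℕ} (h : l ≤ d) : pseudoCubic m l d ≤ (m + 1) ^ d :=
  (pseudoCubic_mono_right h le_rfl).trans_eq (pseudoCubic_self m d)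

lemma pow_le_pseudoCubic {m l d : ℕ} (h : l ≤ d) : m ^ d ≤ pseudoCubic m l d :=
  (pseudoCubic_zero m d).symm.trans_le (pseudoCubic_mono_right (Nat.zero_le l) h)

lemma pseudoCubic_mono {m l m' l' d : ℕ} (h : m < m' ∨ m = m' ∧ l ≤ l') (hl : l ≤ d)
    (hl' : l' ≤ d) : pseudoCubic m l d ≤ pseudoCubic m' l' d := by
  rcases h with h | ⟨rfl, h⟩
  · exact (pseudoCubic_le_pow hl).trans
      ((Nat.pow_le_pow_left h d).trans (pow_le_pseudoCubic hl'))
  · exact pseudoCubic_mono_right h hl'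

/-- Consecutive pseudo cubes: a lexicographically larger one contains the next layer. -/
lemma pseudoCubic_add_layer_le {m l m' l' e : ℕ} (h : m < m' ∨ m = m' ∧ l < l') (hl : l ≤ e)
    (hl' : l' ≤ e + 1) :
    pseudoCubic m l (e + 1) + pseudoCubic m l e ≤ pseudoCubic m' l' (e + 1) := by
  rw [pseudoCubic_add_layer hl]
  exact pseudoCubic_mono (by omega) (by omega) hl'

lemma pseudoCubic_add_layer_le_of_lt {m l m' l' e : ℕ}
    (h : pseudoCubic m l (e + 1) < pseudoCubic m' l' (e + 1)) (hl : l ≤ e) (hl' : l' ≤ e + 1) :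
    pseudoCubic m l (e + 1) + pseudoCubic m l e ≤ pseudoCubic m' l' (e + 1) := by
  refine pseudoCubic_add_layer_le ?_ hl hl'
  by_contra hc
  exact absurd (pseudoCubic_mono (m := m') (l := l') (m' := m) (l' := l) (d := e + 1)
    (by omega) hl' (by omega)) (by omega)

/-- Adding one layer to a pseudo cube gives the next one, so the intervals between consecutive
pseudo cubes tile the positive integers. After `l = e` the next cube is `(m + 1) ^ (e + 1)`, renamed
`(m + 1, 0)`. -/
lemma exists_block (e n : ℕ) (hn : 1 ≤ n) : ∃ p : ℕ × ℕ, 1 ≤ p.1 ∧ p.2 ≤ e ∧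
    pseudoCubic p.1 p.2 (e + 1) ≤ n ∧
    n < pseudoCubic p.1 p.2 (e + 1) + pseudoCubic p.1 p.2 e := by
  induction n, hn using Nat.le_induction with
  | base => exact ⟨(1, 0), by simp [pseudoCubic]⟩
  | succ n hn ih =>
    obtain ⟨⟨m, l⟩, hm, hl, h1, h2⟩ := ih
    simp only at hm hl h1 h2
    rcases Nat.lt_or_ge (n + 1) (pseudoCubic m l (e + 1) + pseudoCubic m l e) with h | h
    · exact ⟨(m, l), hm, hl, by simp only; omega, h⟩
    have hn : n + 1 = pseudoCubic m (l + 1) (e + 1) := by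
      rw [← pseudoCubic_add_layer hl]; omega
    rcases hl.lt_or_eq with hl | rfl
    · refine ⟨(m, l + 1), hm, hl, hn.ge, ?_⟩
      have := pseudoCubic_pos (l + 1) e hm
      simp only; omega
    · refine ⟨(m + 1, 0), by simp, by simp, ?_, ?_⟩ <;>
        rw [hn, pseudoCubic_self, pseudoCubic_zero]
      simp [pseudoCubic_zero]

lemma block_le_of_le {e n n' m l m' l' : ℕ} (hl : l ≤ e)
    (hl' : l' ≤ e) (h' : pseudoCubic m' l' (e + 1) ≤ n')
    (h : n < pseudoCubic m l (e + 1) + pseudoCubic m l e) (hnn : n' ≤ n) :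
    m' < m ∨ m' = m ∧ l' ≤ l := by
  by_contra hc
  exact absurd (pseudoCubic_add_layer_le (m := m) (l := l) (m' := m') (l' := l') (e := e)
    (by omega) hl (by omega)) (by omega)

lemma block_unique {e n m l m' l' : ℕ} (hl : l ≤ e) (hl' : l' ≤ e)
    (h1 : pseudoCubic m l (e + 1) ≤ n) (h2 : n < pseudoCubic m l (e + 1) + pseudoCubic m l e)
    (h1' : pseudoCubic m' l' (e + 1) ≤ n)
    (h2' : n < pseudoCubic m' l' (e + 1) + pseudoCubic m' l' e) : m = m' ∧ l = l' := by
  have := block_le_of_le hl hl' h1' h2 le_rfl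
  have := block_le_of_le hl' hl h1 h2' le_rfl
  omega

/-! ### The greedy facet function. -/

/-- The sum over the coordinate directions of the sizes of the facets of a pseudo cube. -/
def cubeFacets (m l d : ℕ) : ℕ :=
  l * pseudoCubic m (l - 1) (d - 1) + (d - l) * pseudoCubic m l (d - 1)

/-- A full layer glued on a facet adds nothing to the projection in its own direction, and its own
facets to the others. -/
lemma cubeFacets_add_layer {m l e : ℕ} (h : l ≤ e) :
    cubeFacets m l (e + 1) + cubeFacets m l e = cubeFacets m (l + 1) (e + 1) := by
  obtain ⟨k, rfl⟩ := Nat.exists_eq_add_of_le h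
  have e1 : l + k + 1 - l = k + 1 := by omega
  have e2 : l + k - l = k := by omega
  have e3 : l + k + 1 - (l + 1) = k := by omega
  simp only [cubeFacets, e1, e2, e3, Nat.add_sub_cancel]
  have hA : l * pseudoCubic m l (l + k) =
      l * pseudoCubic m (l - 1) (l + k) + l * pseudoCubic m (l - 1) (l + k - 1) := by
    rcases l with _ | l
    · simp
    · rw [Nat.add_right_comm l 1 k, Nat.add_sub_cancel, Nat.add_sub_cancel,
        ← pseudoCubic_add_layer (by omega), mul_add]
  have hB : k * pseudoCubic m (l + 1) (l + k) =
      k * pseudoCubic m l (l + k) + k * pseudoCubic m l (l + k - 1) := by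
    rcases k with _ | k
    · simp
    · rw [← Nat.add_assoc, Nat.add_sub_cancel, ← pseudoCubic_add_layer (by omega), mul_add]
  linarith

lemma cubeFacets_self (m e : ℕ) : cubeFacets m e e = cubeFacets (m + 1) 0 e := by
  rcases e with _ | e
  · simp [cubeFacets]
  · simp [cubeFacets, pseudoCubic_self, pseudoCubic_zero]

/-- The minimal sum of the sizes of the coordinate projections of a set of `n` points in `ℤ^d`,
computed by the greedy decomposition of `n`. -/
noncomputable def minFacets : ℕ → ℕ → ℕ
  | 0, _ => 0
  | e + 1, n =>
    if h : 1 ≤ n then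
      cubeFacets (exists_block e n h).choose.1 (exists_block e n h).choose.2 (e + 1) +
        minFacets e (n - pseudoCubic (exists_block e n h).choose.1
          (exists_block e n h).choose.2 (e + 1))
    else 0

@[simp] lemma minFacets_dim_zero (n : ℕ) : minFacets 0 n = 0 := rfl

@[simp] lemma minFacets_zero (d : ℕ) : minFacets d 0 = 0 := by
  cases d <;> simp [minFacets]

lemma minFacets_block_of_lt {e m l r : ℕ} (hm : 1 ≤ m) (hl : l ≤ e)
    (hr : r < pseudoCubic m l e) :
    minFacets (e + 1) (pseudoCubic m l (e + 1) + r) = cubeFacets m l (e + 1) + minFacets e r := by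
  have hn : 1 ≤ pseudoCubic m l (e + 1) + r := (pseudoCubic_pos l (e + 1) hm).trans (by omega)
  obtain ⟨-, hl', h1, h2⟩ := (exists_block e _ hn).choose_spec
  obtain ⟨e1, e2⟩ := block_unique hl' hl h1 h2 (Nat.le_add_right _ r) (by omega)
  rw [minFacets, dif_pos hn, e1, e2, Nat.add_sub_cancel_left]

lemma minFacets_cube {e m l : ℕ} (hm : 1 ≤ m) (hl : l ≤ e) :
    minFacets e (pseudoCubic m l e) = cubeFacets m l e := by
  rcases e with _ | e
  · obtain rfl : l = 0 := by omega
    simp [cubeFacets]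
  · rcases hl.lt_or_eq with hl | rfl
    · simpa using minFacets_block_of_lt (e := e) (r := 0) hm (Nat.lt_succ_iff.1 hl)
        (pseudoCubic_pos _ _ hm)
    · rw [cubeFacets_self, pseudoCubic_self, ← pseudoCubic_zero]
      simpa using minFacets_block_of_lt (e := e) (m := m + 1) (l := 0) (r := 0) (by omega)
        (by omega) (pseudoCubic_pos _ _ (by omega))

/-- The recursion stays valid for a full layer, where the greedy choice has already passed to the
next cube. This freedom at the boundary is used throughout. -/
lemma minFacets_block {e m l r : ℕ} (hm : 1 ≤ m) (hl : l ≤ e) (hr : r ≤ pseudoCubic m l e) :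
    minFacets (e + 1) (pseudoCubic m l (e + 1) + r) = cubeFacets m l (e + 1) + minFacets e r := by
  rcases hr.lt_or_eq with hr | rfl
  · exact minFacets_block_of_lt hm hl hr
  · rw [pseudoCubic_add_layer hl, minFacets_cube hm (by omega), minFacets_cube hm hl,
      cubeFacets_add_layer hl]

lemma minFacets_one (d : ℕ) : minFacets d 1 = d := by
  have := minFacets_cube (e := d) (m := 1) (l := 0) le_rfl (by omega)
  simpa [pseudoCubic_zero, cubeFacets] using this

lemma exists_block_lt {e n : ℕ} (hn : 1 ≤ n) : ∃ m l r, 1 ≤ m ∧ l ≤ e ∧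
    r < pseudoCubic m l e ∧ n = pseudoCubic m l (e + 1) + r := by
  obtain ⟨⟨m, l⟩, hm, hl, h1, h2⟩ := exists_block e n hn
  exact ⟨m, l, n - pseudoCubic m l (e + 1), hm, hl, by simp only at *; omega,
    by simp only at *; omega⟩

lemma exists_block_pos {e n : ℕ} (hn : 2 ≤ n) : ∃ m l r, 1 ≤ m ∧ l ≤ e ∧ 1 ≤ r ∧
    r ≤ pseudoCubic m l e ∧ n = pseudoCubic m l (e + 1) + r := by
  obtain ⟨m, l, r, hm, hl, hr, h⟩ := exists_block_lt (e := e) (n := n - 1) (by omega)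
  exact ⟨m, l, r + 1, hm, hl, by omega, hr, by omega⟩

/-! ### Merging inequalities. -/

/-- Subadditivity, and the analogous inequality for filling up a pseudo cube. -/
structure MergeIneq (e : ℕ) : Prop where
  add_le : ∀ x y, minFacets e (x + y) ≤ minFacets e x + minFacets e y
  fill_le : ∀ m l x y z, 1 ≤ m → l ≤ e → x ≤ pseudoCubic m l e → y ≤ pseudoCubic m l e →
    x + y = pseudoCubic m l e + z →
    minFacets e (pseudoCubic m l e) + minFacets e z ≤ minFacets e x + minFacets e y

/-- Only the top layers interact: either the whole top layer of `y` moves onto that of `x`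
(subadditivity one dimension lower), or just enough of it to complete the layer of `x` (`fill_le`
one dimension lower). -/
lemma MergeIneq.exists_move {e : ℕ} (H : MergeIneq e) {x y m l r : ℕ} (hy : 1 ≤ y)
    (hyx : y ≤ x) (hm : 1 ≤ m) (hl : l ≤ e) (hr : r < pseudoCubic m l e)
    (hx : x = pseudoCubic m l (e + 1) + r) :
    ∃ a, 1 ≤ a ∧ a ≤ y ∧ r + a ≤ pseudoCubic m l e ∧
      minFacets (e + 1) (x + a) + minFacets (e + 1) (y - a) ≤
        minFacets (e + 1) x + minFacets (e + 1) y := by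
  subst hx
  rcases hy.eq_or_lt with rfl | hy
  · refine ⟨1, le_rfl, le_rfl, hr, ?_⟩
    have h1 := H.add_le r 1
    rw [minFacets_one] at h1
    rw [add_assoc, minFacets_block hm hl hr, minFacets_block hm hl hr.le, minFacets_one]
    simp; omega
  · obtain ⟨m', l', s, hm', hl', hs1, hs, rfl⟩ := exists_block_pos (e := e) hy
    have hA : pseudoCubic m' l' e ≤ pseudoCubic m l e :=
      pseudoCubic_mono (block_le_of_le (n := pseudoCubic m l (e + 1) + r) hl hl'
        (Nat.le_add_right _ s) (by omega) hyx) hl' hl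
    rcases le_or_gt (r + s) (pseudoCubic m l e) with h | h
    · refine ⟨s, hs1, by omega, h, ?_⟩
      have := H.add_le r s
      have e2 := minFacets_block (r := 0) hm' hl' (Nat.zero_le _)
      rw [add_assoc, minFacets_block hm hl h, minFacets_block hm hl hr.le,
        minFacets_block hm' hl' hs, Nat.add_sub_cancel]
      simp at e2
      omega
    · refine ⟨pseudoCubic m l e - r, by omega, by omega, by omega, ?_⟩
      have := H.fill_le m l r s (s - (pseudoCubic m l e - r)) hm hl hr.le (by omega) (by omega)
      rw [add_assoc, Nat.add_sub_cancel' hr.le, Nat.add_sub_assoc (by omega),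
        minFacets_block hm hl le_rfl, minFacets_block hm hl hr.le, minFacets_block hm' hl' hs,
        minFacets_block hm' hl' (by omega)]
      omega

/-- Both inequalities follow by repeating `exists_move` until the smaller number is used up,
respectively until the larger one fills the cube. -/
lemma MergeIneq.succ {e : ℕ} (H : MergeIneq e) : MergeIneq (e + 1) := by
  have add : ∀ y x, y ≤ x →
      minFacets (e + 1) (x + y) ≤ minFacets (e + 1) x + minFacets (e + 1) y := by
    intro y
    induction y using Nat.strong_induction_on with
    | _ y ih =>
      intro x hyx
      rcases Nat.eq_zero_or_pos y with rfl | hy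
      · simp
      obtain ⟨m, l, r, hm, hl, hr, hx⟩ := exists_block_lt (e := e) (n := x) (by omega)
      obtain ⟨a, ha1, hay, -, h⟩ := H.exists_move hy hyx hm hl hr hx
      have := ih (y - a) (by omega) (x + a) (by omega)
      rw [show x + a + (y - a) = x + y by omega] at this
      omega
  have fill : ∀ m l z, 1 ≤ m → l ≤ e + 1 → ∀ y x, y ≤ x → x ≤ pseudoCubic m l (e + 1) →
      x + y = pseudoCubic m l (e + 1) + z →
      minFacets (e + 1) (pseudoCubic m l (e + 1)) + minFacets (e + 1) z ≤
        minFacets (e + 1) x + minFacets (e + 1) y := by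
    intro m l z hm hl y
    induction y using Nat.strong_induction_on with
    | _ y ih =>
      intro x hyx hx hz
      rcases hx.eq_or_lt with rfl | hx
      · rw [Nat.add_left_cancel hz]
      obtain ⟨m', l', r, hm', hl', hr, hx'⟩ := exists_block_lt (e := e) (n := x) (by omega)
      obtain ⟨a, ha1, hay, har, h⟩ := H.exists_move (by omega) hyx hm' hl' hr hx'
      -- A move at most completes the current layer of `x`, which still fits in the target cube.
      have := pseudoCubic_add_layer_le_of_lt (m := m') (l := l') (m' := m) (l' := l) (e := e)
        (by omega) hl' hl
      have := ih (y - a) (by omega) (x + a) (by omega) (by omega) (by omega)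
      omega
  refine ⟨fun x y => ?_, fun m l x y z hm hl hx hy hz => ?_⟩
  · rcases le_total y x with h | h
    · exact add y x h
    · rw [add_comm x, add_comm (minFacets _ x)]; exact add x y h
  · rcases le_total y x with h | h
    · exact fill m l z hm hl y x h hx hz
    · rw [add_comm (minFacets _ x)]
      exact fill m l z hm hl x y h hy (by omega)

lemma mergeIneq (e : ℕ) : MergeIneq e := by
  induction e with
  | zero => exact ⟨by simp, by simp⟩
  | succ e ih => exact ih.succ

/-! ### Removing a thin layer. -/

/-- Adding a layer of `a` points to `n - a` points, where `a` is at most the average of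
`k ≥ n^(1/d)` layers, is at best optimal. -/
lemma minFacets_le_remove_layer (e : ℕ) : ∀ {n k a : ℕ}, 2 ≤ k → n ≤ k ^ (e + 1) → k * a ≤ n →
    minFacets (e + 1) n ≤ minFacets (e + 1) (n - a) + minFacets e a := by
  induction e with
  | zero =>
    intro n k a hk hn ha
    rcases Nat.eq_zero_or_pos a with rfl | ha0
    · simp
    have : n - a ≥ 1 := by nlinarith [Nat.sub_add_cancel (show a ≤ n by nlinarith)]
    have key : ∀ j, 1 ≤ j → minFacets 1 j = 1 := by
      intro j hj
      have := minFacets_cube (e := 1) (l := 0) hj (by omega)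
      simpa [pseudoCubic_zero, cubeFacets] using this
    rw [zero_add, key n (by omega), key _ this]
    omega
  | succ e ih =>
    intro n k a hk hn ha
    rcases Nat.lt_or_ge n 2 with h | h2
    · obtain rfl : a = 0 := by nlinarith
      simp
    -- Taking `1 ≤ r` makes `m ^ (e + 2) < n ≤ k ^ (e + 2)` strict, hence `m < k`.
    obtain ⟨m, l, r, hm, hl, hr1, hr, rfl⟩ := exists_block_pos (e := e + 1) h2
    have hmk : m < k := by
      have : m ^ (e + 1 + 1) < k ^ (e + 1 + 1) :=
        (pow_le_pseudoCubic (l := l) (by omega)).trans_lt (by omega)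
      exact lt_of_pow_lt_pow_left₀ _ (Nat.zero_le k) this
    have ha' : (m + 1) * a ≤ pseudoCubic m l (e + 1 + 1) + r :=
      (Nat.mul_le_mul_right a hmk).trans ha
    have H := mergeIneq (e + 1)
    rcases le_or_gt a r with har | har
    · rw [Nat.add_sub_assoc har, minFacets_block hm hl hr, minFacets_block hm hl (by omega)]
      have := H.add_le (r - a) a
      rw [Nat.sub_add_cancel har] at this
      omega
    -- For `a > r` the removal also cuts into the layer completing the current cube, so `n - a` is
    -- described by the preceding cube `(m', l')`.
    have step : ∀ m' l', 1 ≤ m' → l' ≤ e + 1 → a - r ≤ pseudoCubic m' l' (e + 1) →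
        pseudoCubic m l (e + 1 + 1) = pseudoCubic m' l' (e + 1 + 1) + pseudoCubic m' l' (e + 1) →
        minFacets (e + 1) (pseudoCubic m' l' (e + 1)) + minFacets (e + 1) r ≤
          minFacets (e + 1) a + minFacets (e + 1) (pseudoCubic m' l' (e + 1) - (a - r)) →
        minFacets (e + 1 + 1) (pseudoCubic m l (e + 1 + 1) + r) ≤
          minFacets (e + 1 + 1) (pseudoCubic m l (e + 1 + 1) + r - a) + minFacets (e + 1) a := by
      intro m' l' hm' hl' hs hC hf
      have h0 := minFacets_block (r := 0) hm hl (Nat.zero_le _)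
      rw [add_zero, minFacets_zero, add_zero, hC, minFacets_block hm' hl' le_rfl] at h0
      have h1 : pseudoCubic m l (e + 1 + 1) + r - a = pseudoCubic m' l' (e + 1 + 1) +
        (pseudoCubic m' l' (e + 1) - (a - r)) := by omega
      rw [h1, minFacets_block hm hl hr, minFacets_block hm' hl' (by omega)]
      omega
    rcases l with _ | l
    · have hC : pseudoCubic m 0 (e + 1 + 1) = m * pseudoCubic m 0 (e + 1) :=
        pseudoCubic_succ_dim (by omega)
      rw [hC] at ha'
      have haA : a ≤ pseudoCubic m 0 (e + 1) := by nlinarith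
      obtain ⟨m, rfl⟩ := Nat.exists_eq_add_of_le' hm
      rcases Nat.eq_zero_or_pos m with rfl | hm0
      · simp [pseudoCubic_zero] at haA
        omega
      have hA : pseudoCubic m (e + 1) (e + 1) = pseudoCubic (m + 1) 0 (e + 1) := by
        rw [pseudoCubic_self, pseudoCubic_zero]
      refine step m (e + 1) hm0 le_rfl (by omega) ?_ ?_
      · rw [pseudoCubic_add_layer le_rfl, pseudoCubic_self, pseudoCubic_zero]
      · exact H.fill_le m (e + 1) a _ r hm0 le_rfl (by omega) (by omega) (by omega)
    · have hC := pseudoCubic_add_layer (m := m) (l := l) (e := e + 1) (by omega)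
      have hC' := pseudoCubic_succ_succ m l (e + 1)
      have hA := pseudoCubic_add_layer (m := m) (l := l) (e := e) (by omega)
      rw [hC'] at ha'
      have hs : a - r ≤ pseudoCubic m l (e + 1) := by
        have : (m + 1) * (a - r) ≤ (m + 1) * pseudoCubic m l (e + 1) := by
          rw [Nat.mul_sub]
          have : r ≤ (m + 1) * r := Nat.le_mul_of_pos_left r (by omega)
          omega
        exact Nat.le_of_mul_le_mul_left this (by omega)
      refine step m l hm (by omega) hs hC.symm ?_
      rcases le_or_gt a (pseudoCubic m l (e + 1)) with haA | haA
      · exact H.fill_le m l a _ r hm (by omega) haA (by omega) (by omega)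
      -- Here `a` exceeds that layer by `w + 1`, so `fill_le` does not apply. The excess is thin
      -- relative to `r`, and the induction hypothesis removes it from `r` with `m + 1` in place of
      -- `k`.
      obtain ⟨w, rfl⟩ := Nat.exists_eq_add_of_lt haA
      have hw : (m + 1) * (w + 1) ≤ r := by
        rw [add_assoc, mul_add] at ha'
        omega
      have hwr : w + 1 ≤ r := (Nat.le_mul_of_pos_left (w + 1) (by omega)).trans hw
      have hwB : w + 1 ≤ pseudoCubic m l e := by
        have : (m + 1) * (w + 1) ≤ (m + 1) * pseudoCubic m l e := by
          rw [← pseudoCubic_succ_succ]; omega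
        exact Nat.le_of_mul_le_mul_left this (by omega)
      have h0 := minFacets_block (r := 0) hm (show l ≤ e by omega) (Nat.zero_le _)
      rw [add_zero, minFacets_zero, add_zero] at h0
      have := ih (n := r) (k := m + 1) (a := w + 1) (by omega)
        (hr.trans (pseudoCubic_le_pow (by omega))) hw
      rw [add_assoc, minFacets_block hm (by omega) hwB, h0,
        show pseudoCubic m l (e + 1) - (pseudoCubic m l (e + 1) + (w + 1) - r) = r - (w + 1) by
          omega]
      omega

/-! ### Pseudo cubic representations. -/

lemma discrepancy_eq (d c : ℕ) (m l : ℕ → ℕ) :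
    discrepancy d c m l = ∑ i ∈ Finset.Icc c d, cubeFacets (m i) (l i) i := rfl

lemma not_isPCR_zero {n c : ℕ} {m l : ℕ → ℕ} : ¬ IsPCR 0 n c m l := fun h => by
  have := h.one_le_c
  have := h.c_le
  omega

lemma isPCR_succ_iff {d n c : ℕ} {m l : ℕ → ℕ} :
    IsPCR (d + 1) n c m l ↔ l (d + 1) < d + 1 ∧
      ((c = d + 1 ∧ 1 ≤ m (d + 1) ∧ n = pseudoCubic (m (d + 1)) (l (d + 1)) (d + 1)) ∨
        ∃ r, n = pseudoCubic (m (d + 1)) (l (d + 1)) (d + 1) + r ∧ IsPCR d r c m l ∧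
          toLex (m d, l d) < toLex (m (d + 1), l (d + 1))) := by
  constructor
  · intro h
    refine ⟨h.l_lt _ (by simp [h.c_le]), ?_⟩
    rcases h.c_le.eq_or_lt with hc | hc
    · subst hc
      exact Or.inl ⟨rfl, h.one_le_m, by simpa using h.sum_eq⟩
    · refine Or.inr ⟨∑ i ∈ Finset.Icc c d, pseudoCubic (m i) (l i) i, ?_,
        ⟨h.one_le_c, by omega, h.one_le_m, fun i hi => h.l_lt i ?_, fun i hi => h.lex i ?_, rfl⟩,
        h.lex d (by simp; omega)⟩
      · rw [h.sum_eq, Finset.sum_Icc_succ_top hc.le, add_comm]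
      · simp at hi ⊢; omega
      · simp at hi ⊢; omega
  · rintro ⟨hl, ⟨rfl, hm, rfl⟩ | ⟨r, rfl, h, hlex⟩⟩
    · exact ⟨by omega, le_rfl, hm, by simpa using hl, by simp, by simp⟩
    · have hc := h.c_le
      refine ⟨h.one_le_c, by omega, h.one_le_m, fun i hi => ?_, fun i hi => ?_, ?_⟩
      · simp at hi
        rcases hi.2.eq_or_lt with rfl | hi'
        · exact hl
        · exact h.l_lt i (by simp; omega)
      · simp at hi
        rcases hi.2.eq_or_lt with rfl | hi'
        · exact hlex
        · exact h.lex i (by simp; omega)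
      · rw [Finset.sum_Icc_succ_top (by omega), ← h.sum_eq, add_comm]

/-- The leading term of a representation is the greedy one. -/
lemma IsPCR.leading {e n c : ℕ} {m l : ℕ → ℕ} (h : IsPCR (e + 1) n c m l) :
    1 ≤ m (e + 1) ∧ l (e + 1) ≤ e ∧
      pseudoCubic (m (e + 1)) (l (e + 1)) (e + 1) ≤ n ∧
      n < pseudoCubic (m (e + 1)) (l (e + 1)) (e + 1) +
        pseudoCubic (m (e + 1)) (l (e + 1)) e := by
  induction e generalizing n with
  | zero =>
    obtain ⟨hl, ⟨-, hm, rfl⟩ | ⟨r, -, h, -⟩⟩ := isPCR_succ_iff.1 h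
    · exact ⟨hm, by omega, le_rfl, Nat.lt_add_of_pos_right (pseudoCubic_pos _ _ hm)⟩
    · exact (not_isPCR_zero h).elim
  | succ e ih =>
    obtain ⟨hl, ⟨-, hm, rfl⟩ | ⟨r, rfl, h, hlex⟩⟩ := isPCR_succ_iff.1 h
    · exact ⟨hm, by omega, le_rfl, Nat.lt_add_of_pos_right (pseudoCubic_pos _ _ hm)⟩
    · obtain ⟨hm, hl', -, h2⟩ := ih h
      rw [Prod.Lex.toLex_lt_toLex] at hlex
      simp only at hlex
      -- The remainder lies below the successor of its own leading cube, which by the lexicographic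
      -- order is at most one layer of the top cube.
      have := pseudoCubic_add_layer_le (e := e) hlex hl' (by omega)
      refine ⟨?_, by omega, by omega, by omega⟩
      omega

lemma IsPCR.pos {d n c : ℕ} {m l : ℕ → ℕ} (h : IsPCR d n c m l) : 1 ≤ n := by
  rcases d with _ | e
  · exact (not_isPCR_zero h).elim
  · obtain ⟨hm, -, h1, -⟩ := h.leading
    exact (pseudoCubic_pos _ _ hm).trans h1

lemma IsPCR.minFacets_eq {d n c : ℕ} {m l : ℕ → ℕ} (h : IsPCR d n c m l) :
    minFacets d n = discrepancy d c m l := by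
  rw [discrepancy_eq]
  induction d generalizing n with
  | zero => exact (not_isPCR_zero h).elim
  | succ d ih =>
    obtain ⟨hm, hl, -, hlt⟩ := h.leading
    obtain ⟨-, ⟨rfl, -, rfl⟩ | ⟨r, rfl, h, -⟩⟩ := isPCR_succ_iff.1 h
    · simp [minFacets_cube hm (Nat.le_succ_of_le hl)]
    · rw [Finset.sum_Icc_succ_top (Nat.le_succ_of_le h.c_le),
        minFacets_block_of_lt hm hl (by omega), ih h, add_comm]

lemma IsPCR.unique {d n c c' : ℕ} {m l m' l' : ℕ → ℕ} (h : IsPCR d n c m l)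
    (h' : IsPCR d n c' m' l') :
    c = c' ∧ ∀ i ∈ Finset.Icc c d, m i = m' i ∧ l i = l' i := by
  induction d generalizing n with
  | zero => exact (not_isPCR_zero h).elim
  | succ d ih =>
    obtain ⟨hm, hl, h1, h2⟩ := h.leading
    obtain ⟨hm', hl', h1', h2'⟩ := h'.leading
    have htop := block_unique hl hl' h1 h2 h1' h2'
    obtain ⟨-, ⟨rfl, -, hn⟩ | ⟨r, rfl, hr, -⟩⟩ := isPCR_succ_iff.1 h
    · obtain ⟨-, ⟨rfl, -, hn'⟩ | ⟨r', hn', hr', -⟩⟩ := isPCR_succ_iff.1 h'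
      · exact ⟨rfl, by simpa using htop⟩
      · have := hr'.pos
        rw [← htop.1, ← htop.2] at hn'
        omega
    · obtain ⟨-, ⟨rfl, -, hn'⟩ | ⟨r', hn', hr', -⟩⟩ := isPCR_succ_iff.1 h'
      · have := hr.pos
        rw [← htop.1, ← htop.2] at hn'
        omega
      · rw [← htop.1, ← htop.2] at hn'
        obtain rfl := Nat.add_left_cancel hn'
        obtain ⟨rfl, hi⟩ := ih hr hr'
        refine ⟨rfl, fun i hi' => ?_⟩
        rw [Finset.mem_Icc] at hi'
        rcases hi'.2.eq_or_lt with rfl | hlt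
        · exact htop
        · exact hi i (by simp; omega)

lemma IsPCR.congr {d n c : ℕ} {m l m' l' : ℕ → ℕ} (h : IsPCR d n c m l)
    (hm : ∀ i ≤ d, m' i = m i) (hl : ∀ i ≤ d, l' i = l i) : IsPCR d n c m' l' := by
  refine ⟨h.one_le_c, h.c_le, ?_, fun i hi => ?_, fun i hi => ?_, ?_⟩
  · rw [hm c h.c_le]; exact h.one_le_m
  · rw [hl i (by simp at hi; omega)]; exact h.l_lt i hi
  · simp at hi
    rw [hl i (by omega), hm i (by omega), hl _ (by omega), hm _ (by omega)]
    exact h.lex i (by simp; omega)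
  · rw [h.sum_eq]
    refine Finset.sum_congr rfl fun i hi => ?_
    simp at hi
    rw [hl i (by omega), hm i (by omega)]

lemma exists_isPCR (e n : ℕ) (hn : 1 ≤ n) : ∃ c m l, IsPCR (e + 1) n c m l := by
  induction e generalizing n with
  | zero =>
    exact ⟨1, fun _ => n, fun _ => 0, isPCR_succ_iff.2 ⟨by simp, Or.inl ⟨rfl, hn, by
      simp [pseudoCubic_zero]⟩⟩⟩
  | succ e ih =>
    obtain ⟨m₀, l₀, r, hm, hl, hr, rfl⟩ := exists_block_lt (e := e + 1) hn
    rcases Nat.eq_zero_or_pos r with rfl | hr0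
    · exact ⟨e + 1 + 1, fun _ => m₀, fun _ => l₀, isPCR_succ_iff.2 ⟨by omega,
        Or.inl ⟨rfl, hm, rfl⟩⟩⟩
    obtain ⟨c, m, l, h⟩ := ih r hr0
    obtain ⟨-, hl', h1, -⟩ := h.leading
    refine ⟨c, Function.update m (e + 1 + 1) m₀, Function.update l (e + 1 + 1) l₀,
      isPCR_succ_iff.2 ⟨by simp; omega, Or.inr ⟨r, by simp, h.congr ?_ ?_, ?_⟩⟩⟩
    · intro i hi; rw [Function.update_of_ne (by omega)]
    · intro i hi; rw [Function.update_of_ne (by omega)]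
    · rw [Function.update_of_ne (by omega), Function.update_of_ne (by omega),
        Function.update_self, Function.update_self, Prod.Lex.toLex_lt_toLex]
      by_contra hc
      exact absurd (pseudoCubic_mono (m := m₀) (l := l₀) (m' := m (e + 1)) (l' := l (e + 1))
        (d := e + 1) (by simp only at hc; omega) hl (by omega)) (by omega)

/-! ### Projections of finite sets and the lower bound. -/

/-- The projection of `S` along the coordinate direction `i`, as a subset of `{x | x i = 0}`. -/
noncomputable def flatten {d : ℕ} (i : Fin d) (S : Finset (Fin d → ℤ)) : Finset (Fin d → ℤ) :=
  S.image fun x => Function.update x i 0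

lemma flatten_mono {d : ℕ} (i : Fin d) {S T : Finset (Fin d → ℤ)} (h : S ⊆ T) :
    flatten i S ⊆ flatten i T := Finset.image_subset_image h

lemma flatten_union {d : ℕ} (i : Fin d) (S T : Finset (Fin d → ℤ)) :
    flatten i (S ∪ T) = flatten i S ∪ flatten i T := Finset.image_union _ _

lemma insertNth_injective {e : ℕ} (p : Fin (e + 1)) (t : ℤ) :
    Function.Injective (fun x : Fin e → ℤ => Fin.insertNth (α := fun _ => ℤ) p t x) :=
  Fin.insertNth_right_injective (α := fun _ => ℤ) t

/-- Projecting a set that lies in a coordinate hyperplane amounts to projecting in that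
hyperplane. -/
lemma card_flatten_insertNth {e : ℕ} (p : Fin (e + 1)) (t : ℤ) (j : Fin e)
    (T : Finset (Fin e → ℤ)) :
    (flatten (p.succAbove j) (T.image fun x => Fin.insertNth (α := fun _ => ℤ) p t x)).card =
      (flatten j T).card := by
  have : flatten (p.succAbove j) (T.image fun x => Fin.insertNth (α := fun _ => ℤ) p t x) =
      (flatten j T).image fun x => Fin.insertNth (α := fun _ => ℤ) p t x := by
    simp only [flatten, Finset.image_image]
    refine Finset.image_congr fun x _ => ?_
    simp only [Function.comp]
    exact (Fin.insertNth_update (α := fun _ => ℤ) p t j 0 x).symm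
  rw [this, Finset.card_image_of_injective _ (insertNth_injective p t)]

lemma card_le_prod_card_image {d : ℕ} (S : Finset (Fin d → ℤ)) :
    S.card ≤ ∏ i, (S.image fun x => x i).card := by
  rw [← Fintype.card_piFinset]
  refine Finset.card_le_card fun x hx => ?_
  rw [Fintype.mem_piFinset]
  exact fun i => Finset.mem_image_of_mem _ hx

/-- Induction on dimension and size: `T` is a thinnest layer in a direction `i` with the most
layers, and `R` is the rest. `T` is bounded in one dimension less. -/
lemma minFacets_le_sum_flatten (d : ℕ) (S : Finset (Fin d → ℤ)) :
    minFacets d S.card ≤ ∑ i, (flatten i S).card := by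
  induction d with
  | zero => simp
  | succ e ihe =>
  induction hn : S.card using Nat.strong_induction_on generalizing S with
  | _ n ihn =>
  subst hn
  obtain ⟨i, -, hi⟩ := Finset.exists_max_image Finset.univ
    (fun i => (S.image fun x => x i).card) Finset.univ_nonempty
  set k := (S.image fun x => x i).card with hk
  have hSk : S.card ≤ k ^ (e + 1) := by
    refine (card_le_prod_card_image S).trans ?_
    simpa using Finset.prod_le_pow_card Finset.univ
      (fun i => (S.image fun x => x i).card) k fun j hj => hi j hj
  rcases Nat.lt_or_ge k 2 with hk2 | hk2
  · have hS1 : S.card ≤ 1 := hSk.trans (Nat.pow_le_one_iff (by omega) |>.2 (by omega))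
    rcases Nat.le_one_iff_eq_zero_or_eq_one.1 hS1 with h | h
    · simp [h]
    · obtain ⟨x, rfl⟩ := Finset.card_eq_one.1 h
      rw [h, minFacets_one]
      simp [flatten]
  obtain ⟨t, ht, hmin⟩ := Finset.exists_min_image (S.image fun x : Fin (e + 1) → ℤ => x i)
    (fun t : ℤ => (S.filter fun x : Fin (e + 1) → ℤ => x i = t).card) (Finset.card_pos.1 (by omega))
  set T := S.filter fun x => x i = t with hT
  set R := S.filter fun x => ¬ x i = t with hR
  have hcard : T.card + R.card = S.card := Finset.card_filter_add_card_filter_not _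
  have hunion : T ∪ R = S := Finset.filter_union_filter_not_eq _ _
  have hkT : k * T.card ≤ S.card := by
    rw [Finset.card_eq_sum_card_image (fun x => x i) S, ← smul_eq_mul]
    exact Finset.card_nsmul_le_sum _ _ _ hmin
  have hT0 : 0 < T.card := by
    obtain ⟨x, hx, hxt⟩ := Finset.mem_image.1 ht
    exact Finset.card_pos.2 ⟨x, Finset.mem_filter.2 ⟨hx, hxt⟩⟩
  have hTlift : T = (T.image (Fin.removeNth i)).image
      fun x => Fin.insertNth (α := fun _ => ℤ) i t x := by
    rw [Finset.image_image]
    conv_lhs => rw [← Finset.image_id (s := T)]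
    refine Finset.image_congr fun x hx => ?_
    have : x i = t := (Finset.mem_filter.1 hx).2
    simp [Function.comp, ← this]
  have hTcard : (T.image (Fin.removeNth i)).card = T.card := by
    conv_rhs => rw [hTlift]
    rw [Finset.card_image_of_injective _ (insertNth_injective i t)]
  have h1 := minFacets_le_remove_layer e hk2 hSk hkT
  rw [show S.card - T.card = R.card by omega] at h1
  have h2 := ihn R.card (by omega) R rfl
  have h3 := ihe (T.image (Fin.removeNth i))
  rw [hTcard] at h3
  rw [Fin.sum_univ_succAbove _ i] at h2 ⊢
  have h4 : (flatten i R).card ≤ (flatten i S).card :=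
    Finset.card_le_card (flatten_mono i (Finset.filter_subset _ _))
  -- Projecting along another direction keeps coordinate `i`, which separates `T` from `R`.
  have h5 : ∀ j, (flatten (i.succAbove j) R).card +
      (flatten j (T.image (Fin.removeNth i))).card ≤ (flatten (i.succAbove j) S).card := by
    intro j
    rw [← card_flatten_insertNth i t, ← hTlift, ← Finset.card_union_of_disjoint, ← flatten_union,
      Finset.union_comm, hunion]
    rw [Finset.disjoint_left]
    intro x hx hx'
    obtain ⟨y, hy, rfl⟩ := Finset.mem_image.1 hx
    obtain ⟨z, hz, hyz⟩ := Finset.mem_image.1 hx'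
    have := congrFun hyz i
    rw [Function.update_of_ne (Fin.ne_succAbove i j), Function.update_of_ne
      (Fin.ne_succAbove i j)] at this
    exact (Finset.mem_filter.1 hy).2 (this ▸ (Finset.mem_filter.1 hz).2)
  have h6 := Finset.sum_le_sum fun j (_ : j ∈ Finset.univ) => h5 j
  rw [Finset.sum_add_distrib] at h6
  omega

/-! ### Edges, missing upper neighbours and projections. -/

lemma gridGraph_adj_iff {d : ℕ} {x y : Fin d → ℤ} :
    (gridGraph d).Adj x y ↔ ∃ i, y = x + Pi.single i 1 ∨ x = y + Pi.single i 1 := by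
  change ∑ i, |x i - y i| = 1 ↔ _
  constructor
  · intro h
    have hne : ∃ i, x i ≠ y i := by
      by_contra! hc
      simp [hc] at h
    obtain ⟨i, hi⟩ := hne
    have hpos : 1 ≤ |x i - y i| := Int.one_le_abs (sub_ne_zero.2 hi)
    rw [← Finset.add_sum_erase _ _ (Finset.mem_univ i)] at h
    have hnn : 0 ≤ ∑ j ∈ Finset.univ.erase i, |x j - y j| :=
      Finset.sum_nonneg fun _ _ => abs_nonneg _
    have hz : ∀ j, j ≠ i → x j = y j := by
      intro j hj
      have := (Finset.sum_eq_zero_iff_of_nonneg fun _ _ => abs_nonneg _).1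
        (show ∑ j ∈ Finset.univ.erase i, |x j - y j| = 0 by omega) j (by simp [hj])
      simpa [sub_eq_zero] using this
    have h1 : |x i - y i| = 1 := by omega
    refine ⟨i, ?_⟩
    rcases (abs_eq zero_le_one).1 h1 with h1 | h1
    · right
      ext j
      by_cases hj : j = i
      · subst hj; simp; omega
      · simp [hj, hz j hj]
    · left
      ext j
      by_cases hj : j = i
      · subst hj; simp; omega
      · simp [hj, hz j hj]
  · rintro ⟨i, rfl | rfl⟩ <;>
    · rw [Finset.sum_eq_single i] <;> simp +contextual

/-- The points of `S` whose upper neighbour in direction `i` is missing. -/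
noncomputable def tops {d : ℕ} (i : Fin d) (S : Finset (Fin d → ℤ)) : Finset (Fin d → ℤ) :=
  S.filter fun x => ¬ x + Pi.single i 1 ∈ S

lemma inducedEdges_eq {d : ℕ} (S : Finset (Fin d → ℤ)) :
    inducedEdges S = ∑ i, (S.filter fun x => x + Pi.single i 1 ∈ S).card := by
  set D : Finset (Σ _ : Fin d, Fin d → ℤ) :=
    Finset.univ.sigma fun i => S.filter fun x => x + Pi.single i 1 ∈ S with hD
  set φ : (Σ _ : Fin d, Fin d → ℤ) → Sym2 (Fin d → ℤ) :=
    fun p => s(p.2, p.2 + Pi.single p.1 1) with hφ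
  have hinj : Function.Injective φ := by
    rintro ⟨i, x⟩ ⟨j, y⟩ h
    simp only [hφ, Sym2.eq_iff] at h
    rcases h with ⟨rfl, h⟩ | ⟨rfl, h⟩
    · have := congrFun (add_left_cancel h) i
      by_cases hij : i = j
      · rw [hij]
      · simp [hij] at this
    · have := congrFun h i
      have h' : (0 : ℤ) ≤ Pi.single (M := fun _ => ℤ) j 1 i := by
        by_cases hij : i = j
        · subst hij; simp
        · simp [hij]
      simp at this
      omega
  have himage : Sym2.map Subtype.val ''
      ((gridGraph d).induce (S : Set (Fin d → ℤ))).edgeSet = φ '' (D : Set _) := by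
    ext s
    constructor
    · rintro ⟨s, hs, rfl⟩
      induction s with
      | _ x y =>
      rw [SimpleGraph.mem_edgeSet, SimpleGraph.comap_adj, gridGraph_adj_iff] at hs
      obtain ⟨i, h | h⟩ := hs
      · refine ⟨⟨i, x⟩, ?_, ?_⟩
        · have := y.2
          simp only [Function.Embedding.subtype_apply] at h
          rw [h] at this
          simpa [hD] using this
        · simpa [hφ] using h.symm
      · refine ⟨⟨i, y⟩, ?_, ?_⟩
        · have := x.2
          simp only [Function.Embedding.subtype_apply] at h
          rw [h] at this
          simpa [hD] using this
        · simp only [Function.Embedding.subtype_apply] at h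
          simp [hφ, h]
    · rintro ⟨⟨i, x⟩, hx, rfl⟩
      simp [hD] at hx
      refine ⟨s(⟨x, hx.1⟩, ⟨x + Pi.single i 1, hx.2⟩), ?_, by simp [hφ]⟩
      rw [SimpleGraph.mem_edgeSet, SimpleGraph.comap_adj, gridGraph_adj_iff]
      exact ⟨i, Or.inl rfl⟩
  rw [inducedEdges, ← Set.ncard_image_of_injective _ (Sym2.map.injective Subtype.val_injective),
    himage, Set.ncard_image_of_injective _ hinj, Set.ncard_coe_finset, hD, Finset.card_sigma]

lemma inducedEdges_add_tops {d : ℕ} (S : Finset (Fin d → ℤ)) :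
    inducedEdges S + ∑ i, (tops i S).card = d * S.card := by
  rw [inducedEdges_eq, ← Finset.sum_add_distrib]
  simp only [tops, Finset.card_filter_add_card_filter_not]
  simp

/-- The highest point of `S` on each line in direction `i` has no upper neighbour in `S`. -/
lemma card_flatten_le_tops {d : ℕ} (i : Fin d) (S : Finset (Fin d → ℤ)) :
    (flatten i S).card ≤ (tops i S).card := by
  refine le_trans (Finset.card_le_card fun z hz => ?_)
    (Finset.card_image_le (f := fun x => Function.update x i 0))
  obtain ⟨x, hx, rfl⟩ := Finset.mem_image.1 hz
  obtain ⟨y, hy, hmax⟩ := Finset.exists_max_image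
    (S.filter fun y => Function.update y i 0 = Function.update x i 0) (fun y => y i)
    ⟨x, by simpa using hx⟩
  rw [Finset.mem_filter] at hy
  refine Finset.mem_image.2 ⟨y, Finset.mem_filter.2 ⟨hy.1, fun h => ?_⟩, hy.2⟩
  have := hmax (y + Pi.single i 1) (Finset.mem_filter.2 ⟨h, by
    rw [← hy.2]
    ext j
    by_cases hj : j = i
    · subst hj; simp
    · simp [hj]⟩)
  simp at this

/-- Down-closed sets of points with positive coordinates. -/
structure IsDown {d : ℕ} (S : Finset (Fin d → ℤ)) : Prop where
  pos : ∀ x ∈ S, ∀ j, 1 ≤ x j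
  down : ∀ x ∈ S, ∀ y : Fin d → ℤ, (∀ j, 1 ≤ y j) → y ≤ x → y ∈ S

/-- A down-closed set has no gaps along a line, so only the highest point there lacks its upper
neighbour. -/
lemma IsDown.card_tops_le {d : ℕ} {S : Finset (Fin d → ℤ)} (h : IsDown S) (i : Fin d) :
    (tops i S).card ≤ (flatten i S).card := by
  have key : ∀ x ∈ tops i S, ∀ y ∈ tops i S,
      Function.update x i 0 = Function.update y i 0 → y i ≤ x i := by
    intro x hx y hy hxy
    by_contra! hlt
    rw [tops, Finset.mem_filter] at hx hy
    refine hx.2 (h.down y hy.1 _ (fun j => ?_) fun j => ?_)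
    · by_cases hj : j = i
      · subst hj; simpa using (h.pos x hx.1 j).trans' zero_le_one
      · simpa [hj] using h.pos x hx.1 j
    · by_cases hj : j = i
      · subst hj; simpa using hlt
      · have := congrFun hxy j
        simp [hj] at this
        simp [hj, this]
  have hsub : (tops i S).image (fun x => Function.update x i 0) ⊆ flatten i S :=
    Finset.image_subset_image (Finset.filter_subset _ _)
  refine le_trans (le_of_eq ?_) (Finset.card_le_card hsub)
  rw [Finset.card_image_of_injOn]
  intro x hx y hy hxy
  have hi := le_antisymm (key y hy x hx hxy.symm) (key x hx y hy hxy)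
  ext j
  by_cases hj : j = i
  · subst hj; exact hi
  · simpa [hj] using congrFun hxy j

/-! ### Pseudo cubes as point sets, and layers on top of them. -/

lemma mem_pseudoCube {m l d : ℕ} {x : Fin d → ℤ} :
    x ∈ pseudoCube m l d ↔ ∀ i : Fin d, 1 ≤ x i ∧ x i ≤ m + if (i : ℕ) < l then 1 else 0 := by
  simp only [pseudoCube, Fintype.mem_piFinset]
  refine forall_congr' fun i => ?_
  split_ifs <;> simp

lemma prod_ite_lt {m l d : ℕ} (h : l ≤ d) :
    ∏ i : Fin d, (if (i : ℕ) < l then m + 1 else m) = pseudoCubic m l d := by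
  rw [Fin.prod_univ_eq_prod_range (fun i => if i < l then m + 1 else m) d]
  obtain ⟨k, rfl⟩ := Nat.exists_eq_add_of_le h
  rw [Finset.prod_range_add, pseudoCubic, Nat.add_sub_cancel_left]
  congr 1
  · rw [Finset.prod_congr rfl fun i hi => if_pos (Finset.mem_range.1 hi)]
    simp
  · simp

lemma card_pseudoCube {m l d : ℕ} (h : l ≤ d) :
    (pseudoCube m l d).card = pseudoCubic m l d := by
  rw [pseudoCube, Fintype.card_piFinset, ← prod_ite_lt h]
  refine Finset.prod_congr rfl fun i _ => ?_
  split_ifs <;> simp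

lemma succAbove_lt_iff {e : ℕ} (p : Fin (e + 1)) (j : Fin e) {l : ℕ} :
    ((p.succAbove j : ℕ) < l) ↔ (j : ℕ) < if (p : ℕ) < l then l - 1 else l := by
  unfold Fin.succAbove
  simp only [Fin.lt_def]
  split_ifs <;> simp at * <;> omega

lemma card_flatten_pseudoCube_le {m l e : ℕ} (h : l ≤ e) (p : Fin (e + 1)) :
    (flatten p (pseudoCube m l (e + 1))).card ≤
      if (p : ℕ) < l then pseudoCubic m (l - 1) e else pseudoCubic m l e := by
  have hsub : flatten p (pseudoCube m l (e + 1)) ⊆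
      (pseudoCube m (if (p : ℕ) < l then l - 1 else l) e).image
        fun x => Fin.insertNth (α := fun _ => ℤ) p 0 x := by
    intro z hz
    obtain ⟨x, hx, rfl⟩ := Finset.mem_image.1 hz
    refine Finset.mem_image.2 ⟨Fin.removeNth p x, ?_, by simp⟩
    rw [mem_pseudoCube] at hx ⊢
    intro j
    simpa only [succAbove_lt_iff, Fin.removeNth_apply] using hx (p.succAbove j)
  refine (Finset.card_le_card hsub).trans (Finset.card_image_le.trans ?_)
  rw [card_pseudoCube (by split_ifs <;> omega)]
  split_ifs <;> rfl

lemma sum_card_flatten_pseudoCube_le {m l e : ℕ} (h : l ≤ e) :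
    ∑ p, (flatten p (pseudoCube m l (e + 1))).card ≤ cubeFacets m l (e + 1) := by
  refine (Finset.sum_le_sum fun p _ => card_flatten_pseudoCube_le h p).trans_eq ?_
  rw [Fin.sum_univ_eq_sum_range
    (fun i => if i < l then pseudoCubic m (l - 1) e else pseudoCubic m l e) (e + 1)]
  obtain ⟨k, hk⟩ := Nat.exists_eq_add_of_le (show l ≤ e + 1 by omega)
  rw [cubeFacets, Nat.add_sub_cancel, hk, Finset.sum_range_add, Nat.add_sub_cancel_left,
    Finset.sum_congr rfl fun i hi => if_pos (Finset.mem_range.1 hi)]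
  simp

lemma pseudoCube_subset {m l m' l' d : ℕ} (h : m < m' ∨ m = m' ∧ l ≤ l') :
    pseudoCube m l d ⊆ pseudoCube m' l' d := by
  intro x hx
  rw [mem_pseudoCube] at hx ⊢
  intro i
  have := hx i
  split_ifs at this ⊢ <;> omega

lemma isDown_pseudoCube (m l d : ℕ) : IsDown (pseudoCube m l d) where
  pos _ hx j := (mem_pseudoCube.1 hx j).1
  down _ hx _ hy hyx := mem_pseudoCube.2 fun j =>
    ⟨hy j, (hyx j).trans (mem_pseudoCube.1 hx j).2⟩

section Lift

variable {e m : ℕ} {p : Fin (e + 1)} {K : Finset (Fin e → ℤ)}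

/-- The pseudo cube `⟦m,p⟧^(e+1)` with the set `K` placed on top of it in direction `p`. -/
noncomputable def addLayer (m : ℕ) (p : Fin (e + 1)) (K : Finset (Fin e → ℤ)) :
    Finset (Fin (e + 1) → ℤ) :=
  pseudoCube m p (e + 1) ∪
    K.image fun x => Fin.insertNth (α := fun _ => ℤ) p ((m : ℤ) + 1) x

lemma card_addLayer : (addLayer m p K).card = pseudoCubic m p (e + 1) + K.card := by
  rw [addLayer, Finset.card_union_of_disjoint, card_pseudoCube p.2.le,
    Finset.card_image_of_injective _ (insertNth_injective p _)]
  rw [Finset.disjoint_left]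
  intro x hx hx'
  obtain ⟨y, -, rfl⟩ := Finset.mem_image.1 hx'
  have := (mem_pseudoCube.1 hx p).2
  simp at this

lemma insertNth_mem_pseudoCube {x : Fin e → ℤ} {t : ℤ} {l : ℕ} (hx : x ∈ pseudoCube m p e)
    (ht : 1 ≤ t) (ht' : t ≤ m + if (p : ℕ) < l then 1 else 0) (hl : (p : ℕ) ≤ l) :
    Fin.insertNth (α := fun _ => ℤ) p t x ∈ pseudoCube m l (e + 1) := by
  rw [mem_pseudoCube] at hx ⊢
  rw [Fin.forall_iff_succAbove p]
  refine ⟨by simpa using ⟨ht, ht'⟩, fun j => ?_⟩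
  have := hx j
  simp only [Fin.insertNth_apply_succAbove, succAbove_lt_iff]
  refine ⟨this.1, this.2.trans ?_⟩
  split_ifs <;> omega

lemma addLayer_subset (hK : K ⊆ pseudoCube m p e) :
    addLayer m p K ⊆ pseudoCube m (p + 1) (e + 1) := by
  refine Finset.union_subset (pseudoCube_subset (by omega)) fun x hx => ?_
  obtain ⟨y, hy, rfl⟩ := Finset.mem_image.1 hx
  exact insertNth_mem_pseudoCube (hK hy) (by omega) (by simp) (by omega)

lemma isDown_addLayer (hK : K ⊆ pseudoCube m p e) (h : IsDown K) : IsDown (addLayer m p K) where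
  pos x hx := (isDown_pseudoCube _ _ _).pos x (addLayer_subset hK hx)
  down x hx y hy hyx := by
    rcases Finset.mem_union.1 hx with hx | hx
    · exact Finset.mem_union_left _ ((isDown_pseudoCube _ _ _).down x hx y hy hyx)
    obtain ⟨z, hz, rfl⟩ := Finset.mem_image.1 hx
    have hyz : Fin.removeNth p y ∈ K := h.down z hz _ (fun j => hy _) fun j => by
      simpa [Fin.removeNth_apply] using hyx (p.succAbove j)
    have hp : y p ≤ m + 1 := by simpa using hyx p
    have hy' : Fin.insertNth (α := fun _ => ℤ) p (y p) (Fin.removeNth p y) = y := by simp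
    rcases hp.eq_or_lt with hp | hp
    · exact Finset.mem_union_right _ (Finset.mem_image.2 ⟨_, hyz, by rw [← hp]; exact hy'⟩)
    · rw [← hy']
      exact Finset.mem_union_left _
        (insertNth_mem_pseudoCube (hK hyz) (hy p) (by simp; omega) le_rfl)

/-- In direction `p` the layer projects into the shadow of the box: since `1 ≤ m`, each of its
points has one of the box below it at height `1`. -/
lemma sum_card_flatten_addLayer_le (hm : 1 ≤ m) (hK : K ⊆ pseudoCube m p e) :
    ∑ i, (flatten i (addLayer m p K)).card ≤
      cubeFacets m p (e + 1) + ∑ j, (flatten j K).card := by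
  have hbox := sum_card_flatten_pseudoCube_le (m := m) (Nat.lt_succ_iff.1 p.2)
  refine le_trans ?_ (Nat.add_le_add_right hbox _)
  rw [Fin.sum_univ_succAbove _ p, Fin.sum_univ_succAbove _ p, add_assoc,
    ← Finset.sum_add_distrib]
  refine Nat.add_le_add (Finset.card_le_card ?_) (Finset.sum_le_sum fun j _ => ?_)
  · rw [addLayer, flatten_union]
    refine Finset.union_subset le_rfl fun z hz => ?_
    obtain ⟨x, hx, rfl⟩ := Finset.mem_image.1 hz
    obtain ⟨y, hy, rfl⟩ := Finset.mem_image.1 hx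
    refine Finset.mem_image.2 ⟨Fin.insertNth (α := fun _ => ℤ) p 1 y,
      insertNth_mem_pseudoCube (hK hy) le_rfl (by simpa using hm) le_rfl, ?_⟩
    simp
  · rw [addLayer, flatten_union]
    refine (Finset.card_union_le _ _).trans (Nat.add_le_add_left ?_ _)
    rw [card_flatten_insertNth]

end Lift

/-! ### The cubicle attains the bound. -/

lemma cubicle_succ {c d : ℕ} {m l : ℕ → ℕ} (hc : c ≤ d + 1) (hl : l (d + 1) < d + 1) :
    cubicle c m l (d + 1) = addLayer (m (d + 1)) ⟨l (d + 1), hl⟩ (cubicle c m l d) := by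
  have : Fin.ofNat (d + 1) (l (d + 1)) = ⟨l (d + 1), hl⟩ := by
    ext; simp [Nat.mod_eq_of_lt hl]
  rw [cubicle, if_neg (by omega), addLayer, this]

lemma cubicle_of_lt {c d : ℕ} {m l : ℕ → ℕ} (h : d < c) : cubicle c m l d = ∅ := by
  cases d with
  | zero => rfl
  | succ d => rw [cubicle, if_pos h]

/-- Containment in the next pseudo cube drives the induction: with the lexicographic order it makes
the lower cubicle fit on the facet where it is placed. -/
lemma IsPCR.cubicle_spec {d n c : ℕ} {m l : ℕ → ℕ} (h : IsPCR d n c m l) :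
    (cubicle c m l d).card = n ∧ IsDown (cubicle c m l d) ∧
      cubicle c m l d ⊆ pseudoCube (m d) (l d + 1) d ∧
      ∑ i, (flatten i (cubicle c m l d)).card ≤ minFacets d n := by
  induction d generalizing n with
  | zero => exact (not_isPCR_zero h).elim
  | succ d ih =>
    obtain ⟨hm, hl, -, hlt⟩ := h.leading
    have hl' : l (d + 1) < d + 1 := Nat.lt_succ_of_le hl
    have build : ∀ r, n = pseudoCubic (m (d + 1)) (l (d + 1)) (d + 1) + r →
        (cubicle c m l d).card = r → IsDown (cubicle c m l d) →
        cubicle c m l d ⊆ pseudoCube (m (d + 1)) (l (d + 1)) d →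
        ∑ i, (flatten i (cubicle c m l d)).card ≤ minFacets d r →
        (cubicle c m l (d + 1)).card = n ∧ IsDown (cubicle c m l (d + 1)) ∧
          cubicle c m l (d + 1) ⊆ pseudoCube (m (d + 1)) (l (d + 1) + 1) (d + 1) ∧
          ∑ i, (flatten i (cubicle c m l (d + 1))).card ≤ minFacets (d + 1) n := by
      intro r hn hcard hdown hsub hsum
      rw [cubicle_succ h.c_le hl']
      refine ⟨by rw [card_addLayer, hcard, hn],
        isDown_addLayer (p := ⟨l (d + 1), hl'⟩) hsub hdown,
        addLayer_subset (p := ⟨l (d + 1), hl'⟩) hsub, ?_⟩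
      have hF : minFacets (d + 1) n = cubeFacets (m (d + 1)) (l (d + 1)) (d + 1) +
          minFacets d r := by
        rw [hn]
        exact minFacets_block_of_lt hm hl (by omega)
      rw [hF]
      exact (sum_card_flatten_addLayer_le (p := ⟨l (d + 1), hl'⟩) hm hsub).trans
        (Nat.add_le_add_left hsum _)
    obtain ⟨-, ⟨rfl, -, hn⟩ | ⟨r, hn, hr, hlex⟩⟩ := isPCR_succ_iff.1 h
    · have h0 := cubicle_of_lt (m := m) (l := l) (Nat.lt_succ_self d)
      refine build 0 hn ?_ ?_ ?_ ?_ <;> rw [h0]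
      · rfl
      · exact ⟨by simp, by simp⟩
      · simp
      · simp [flatten]
    · obtain ⟨h1, h2, h3, h4⟩ := ih hr
      rw [Prod.Lex.toLex_lt_toLex] at hlex
      exact build r hn h1 h2 (h3.trans (pseudoCube_subset (by simp only at hlex; omega))) h4

theorem theorem1 (d n : ℕ) (hd : 1 ≤ d) (hn : 1 ≤ n) :
    -- the pseudo `d`-cubic representation of `n` exists
    (∃ (c : ℕ) (m l : ℕ → ℕ), IsPCR d n c m l) ∧
    -- and is unique
    (∀ (c : ℕ) (m l : ℕ → ℕ) (c' : ℕ) (m' l' : ℕ → ℕ),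
      IsPCR d n c m l → IsPCR d n c' m' l' →
        c = c' ∧ ∀ i ∈ Finset.Icc c d, m i = m' i ∧ l i = l' i) ∧
    -- it determines the maximum number of induced edges, which the cubicle attains
    (∀ (c : ℕ) (m l : ℕ → ℕ), IsPCR d n c m l →
      IsGreatest {e : ℤ | ∃ S : Finset (Fin d → ℤ), S.card = n ∧ (inducedEdges S : ℤ) = e}
        ((d : ℤ) * n - discrepancy d c m l) ∧
      (cubicle c m l d).card = n ∧
      (∀ x ∈ cubicle c m l d, ∀ j, 1 ≤ x j) ∧
      (inducedEdges (cubicle c m l d) : ℤ) = (d : ℤ) * n - discrepancy d c m l) := by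
  refine ⟨?_, fun c m l c' m' l' h h' => h.unique h', fun c m l h => ?_⟩
  · obtain ⟨e, rfl⟩ := Nat.exists_eq_add_of_le' hd
    exact exists_isPCR e n hn
  · have upper : ∀ S : Finset (Fin d → ℤ), S.card = n →
        (inducedEdges S : ℤ) ≤ (d : ℤ) * n - discrepancy d c m l := by
      rintro S rfl
      have h1 := minFacets_le_sum_flatten d S
      have h2 := Finset.sum_le_sum fun i (_ : i ∈ Finset.univ) => card_flatten_le_tops i S
      have h3 := inducedEdges_add_tops S
      rw [h.minFacets_eq] at h1
      zify at h1 h2 h3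
      linarith
    obtain ⟨hcard, hdown, -, hsum⟩ := h.cubicle_spec
    have hedges : (inducedEdges (cubicle c m l d) : ℤ) = (d : ℤ) * n - discrepancy d c m l := by
      refine le_antisymm (upper _ hcard) ?_
      have h2 := Finset.sum_le_sum fun i (_ : i ∈ Finset.univ) => hdown.card_tops_le i
      have h3 := inducedEdges_add_tops (cubicle c m l d)
      rw [h.minFacets_eq] at hsum
      rw [hcard] at h3
      zify at hsum h2 h3
      linarith
    refine ⟨⟨⟨_, hcard, hedges⟩, ?_⟩, hcard, hdown.pos, hedges⟩
    rintro _ ⟨S, hS, rfl⟩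
    exact upper S hS
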